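/- Setting. In the simultaneous message passing (SMP) model Alice holds $x\in\{0,1\}^n$, Bob holds $y\in\{0,1\}^n$ ($n\ge 1$), and each sends one message to a referee. Let $f:D\to\{0,1\}$, $D\subseteq\{0,1\}^n\times\{0,1\}^n$, be a (possibly partial) Boolean function. A protocol that outputs $1$ with probability $P(x,y)$ on input $(x,y)$ computes $f$ with error $\varepsilon$ if $P(x,y)\ge 1-\varepsilon$ whenever $f(x,y)=1$ and $P(x,y)\le\varepsilon$ whenever $f(x,y)=0$. In a classical public-coin protocol with $c$-bit messages, a random element $\omega$ of a probability space is drawn and shown to all parties, Alice and Bob send messages $a_{\omega x},b_{\omega y}\in\{0,1\}^c$, and the (possibly randomized) referee outputs a bit depending on the two messages and possibly on $\omega$; $P(x,y)$ is the resulting probability of output $1$. In a repeated fingerprinting protocol with parameters $q,r$ there is no coin: Alice sends $r$ copies of a $q$-qubit pure state $|\alpha_x\rangle$ with real amplitudes, Bob sends $r$ copies of a $q$-qubit pure state $|\beta_y\rangle$ with real amplitudes, and the referee performs $r$ swap tests in parallel, one on each pair $|\alpha_x\rangle|\beta_y\rangle$, where the swap test is the measurement $\{(I+\mathrm{SWAP})/2,\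 (I-\mathrm{SWAP})/2\}$ with outcomes $0$ and $1$ respectively (so that outcome $0$ has probability $\frac12+\frac12|\langle\alpha_x|\beta_y\rangle|^2$). His output is a function of the $r$ outcome bits. The cost is $2qr$ qubits. A $(d,\delta_0,\delta_1)$-threshold embedding of $f$ is an assignment of unit vectors $\alpha_x,\beta_y\in\mathbb{R}^d$ to all $x,y$ such that $|\langle\alpha_x,\beta_y\rangle|^2\le\delta_0$ whenever $f(x,y)=0$ and $|\langle\alpha_x,\beta_y\rangle|^2\ge\delta_1$ whenever $f(x,y)=1$. Theorem. (i) For every classical public-coin protocol with $c$-bit messages whose public coin is uniformly distributed over $n'\ge 1$ values there are unit vectors $\alpha_x,\beta_y\in\mathbb{R}^d$, $d=n'(2^c+1)$, with $\langle\alpha_x,\beta_y\rangle=P(x,y)/\sqrt{2^c}$ for all $x,y$. These vectors form a $\left(d,\frac{1}{9\cdot 2^c},\frac{4}{9\cdot 2^c}\right)$-threshold embedding of every $f$ that the protocol computes with error $1/3$. (ii) There is a universal constant $C$ such that for all $n\ge 1$ and $c\ge 0$ and every $f$ as above: if some classical public-coin protocol with $c$-bit messages computes $f$ with error $1/3$,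 then some repeated fingerprinting protocol computes $f$ with error $1/3$ at a cost of at most $C\cdot 2^{2c}(c+\log_2 n)$ qubits. -/

import Mathlib

open MeasureTheory ProbabilityTheory

noncomputable section

/-- Bit strings of length `n`. -/
abbrev BitString (n : ℕ) : Type := Fin n → Bool

/-- A (possibly partial) Boolean function `f : D → {0,1}`, `D ⊆ X × Y`, is computed with worst-case
error `ε` by a protocol whose probability of output `1` on input `(x, y)` is `P x y`. -/
def ComputesWithError {X Y : Type*} (P : X → Y → ℝ) {D : Set (X × Y)} (f : D → Bool) (ε : ℝ) :
    Prop :=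
  ∀ p : D, (f p = true → 1 - ε ≤ P p.1.1 p.1.2) ∧ (f p = false → P p.1.1 p.1.2 ≤ ε)

/-- A classical public-coin simultaneous message passing protocol with `c`-bit messages, the public
coin taking values in `Ω`. The referee may be randomized and may see the public coin:
`referee ω a b` is the probability that he outputs `1` on messages `a`, `b` when the coin is `ω`
(a deterministic referee `R(a, b)` is a `{0,1}`-valued function that does not depend on `ω`). -/
structure PublicCoinSMP (Ω X Y : Type*) [MeasurableSpace Ω] (c : ℕ) where
  alice : Ω → X → BitString c
  bob : Ω → Y → BitString c
  referee : Ω → BitString c → BitString c → ℝ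
  referee_mem : ∀ ω a b, referee ω a b ∈ Set.Icc (0 : ℝ) 1
  measurable_alice : ∀ x, Measurable fun ω => alice ω x
  measurable_bob : ∀ y, Measurable fun ω => bob ω y
  measurable_referee : ∀ a b, Measurable fun ω => referee ω a b

/-- The probability `P(x, y)` that the protocol outputs `1`, if the public coin has law `μ`. -/
def PublicCoinSMP.acceptProb {Ω X Y : Type*} [MeasurableSpace Ω] {c : ℕ}
    (π : PublicCoinSMP Ω X Y c) (μ : Measure Ω) (x : X) (y : Y) : ℝ :=
  ∫ ω, π.referee ω (π.alice ω x) (π.bob ω y) ∂μ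

/-- Unit vectors `α x`, `β y` in `ℝ^d` form a `(d, δ₀, δ₁)`-threshold embedding of `f`. -/
def IsThresholdEmbedding {X Y : Type*} {D : Set (X × Y)} (f : D → Bool) (d : ℕ) (δ₀ δ₁ : ℝ)
    (α : X → EuclideanSpace ℝ (Fin d)) (β : Y → EuclideanSpace ℝ (Fin d)) : Prop :=
  (∀ x, ‖α x‖ = 1) ∧ (∀ y, ‖β y‖ = 1) ∧
    ∀ p : D, (f p = false → |inner ℝ (α p.1.1) (β p.1.2)| ^ 2 ≤ δ₀) ∧
      (f p = true → δ₁ ≤ |inner ℝ (α p.1.1) (β p.1.2)| ^ 2)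

/-- The operator exchanging two registers with basis `ι`: `|i⟩|j⟩ ↦ |j⟩|i⟩`. -/
def swapMatrix (ι : Type*) [DecidableEq ι] : Matrix (ι × ι) (ι × ι) ℝ :=
  Matrix.of fun p p' => if p = p'.swap then 1 else 0

/-- The two-outcome measurement of the swap test: `(I + SWAP)/2` for outcome `0` (`false`),
`(I - SWAP)/2` for outcome `1` (`true`). -/
def swapTest (ι : Type*) [DecidableEq ι] : Bool → Matrix (ι × ι) (ι × ι) ℝ
  | false => (1 / 2 : ℝ) • (1 + swapMatrix ι)
  | true => (1 / 2 : ℝ) • (1 - swapMatrix ι)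

/-- `r` swap tests in parallel: the tensor product measurement, whose element for the outcome string
`s` is `E_{s 0} ⊗ ⋯ ⊗ E_{s (r-1)}`. -/
def parallelSwapTest (ι : Type*) [DecidableEq ι] (r : ℕ) (s : BitString r) :
    Matrix (Fin r → ι × ι) (Fin r → ι × ι) ℝ :=
  Matrix.of fun z w => ∏ i, swapTest ι (s i) (z i) (w i)

/-- The state `(|α⟩|β⟩)^{⊗ r}` that the referee receives, as a vector of amplitudes. -/
def jointState {ι : Type*} [Fintype ι] (r : ℕ) (α β : EuclideanSpace ℝ ι) :
    (Fin r → ι × ι) → ℝ :=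
  fun z => ∏ i, α (z i).1 * β (z i).2

/-- A repeated fingerprinting protocol (with real amplitudes and no coins): Alice sends `r` copies of
a `q`-qubit pure state depending on `x`, Bob sends `r` copies of a `q`-qubit pure state depending on
`y`, and the referee's output is a function of the outcomes of `r` swap tests. -/
structure RepeatedFingerprinting (X Y : Type*) (q r : ℕ) where
  alice : X → EuclideanSpace ℝ (BitString q)
  bob : Y → EuclideanSpace ℝ (BitString q)
  norm_alice : ∀ x, ‖alice x‖ = 1
  norm_bob : ∀ y, ‖bob y‖ = 1
  referee : BitString r → Bool

/-- The probability `Tr(E_s ρ)` that the swap tests have outcomes `s`, where `ρ = |ψ⟩⟨ψ|` is the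
joint state received by the referee. -/
def RepeatedFingerprinting.outcomeProb {X Y : Type*} {q r : ℕ}
    (F : RepeatedFingerprinting X Y q r) (x : X) (y : Y) (s : BitString r) : ℝ :=
  (parallelSwapTest (BitString q) r s *
    Matrix.vecMulVec (jointState r (F.alice x) (F.bob y))
      (jointState r (F.alice x) (F.bob y))).trace

/-- The probability that the referee outputs `1`. -/
def RepeatedFingerprinting.acceptProb {X Y : Type*} {q r : ℕ}
    (F : RepeatedFingerprinting X Y q r) (x : X) (y : Y) : ℝ :=
  ∑ s : BitString r, if F.referee s = true then F.outcomeProb x y s else 0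

/-- The total number of qubits sent: `r` copies of a `q`-qubit state from each of the two parties. -/
def RepeatedFingerprinting.cost {X Y : Type*} {q r : ℕ} (_F : RepeatedFingerprinting X Y q r) : ℕ :=
  2 * q * r

end

noncomputable section

/-! ### Moments of a product distribution on a finite alphabet -/

/-! For a fixed coin value, the acceptance probability of the referee is an inner product. Alice's
vector is the indicator of her message, and Bob's lists the referee's acceptance probabilities
against each possible message. Bob's list has norm at most `√(2 ^ c)`, so after division by `√(2 ^
c)` one extra coordinate, where Alice has `0`, completes it to a unit vector. Superposing over the
coin values averages these inner products, which gives (i).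

For (ii), Hoeffding's inequality and a union bound over all input pairs replace the coin by `O(n)`
values at the price of error `3/8`, so the fingerprints need only `O(c + log n)` qubits. The squared
inner products then differ by a gap of order `2 ^ (-c)`. Swap tests on separate copies are
independent coins with bias given by the squared inner product, and by Chebyshev `O(4 ^ c)` of them
detect the gap. -/

lemma sum_prod_weights_eq_one {ι κ : Type*} [Fintype ι] [DecidableEq ι] [Fintype κ] (w : κ → ℝ)
    (hw : ∑ k, w k = 1) : ∑ s : ι → κ, ∏ i, w (s i) = 1 := by
  rw [← Fintype.piFinset_univ, Finset.sum_prod_piFinset]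
  simp [hw]

/-- The offset `u` drives the induction: splitting off the first letter `k` turns it into `u + g k`,
and the cross term vanishes because `g` is centred. -/
lemma sum_prod_weights_mul_sq {κ : Type*} [Fintype κ] (w g : κ → ℝ) (hw : ∑ k, w k = 1)
    (hg : ∑ k, w k * g k = 0) (r : ℕ) (u : ℝ) :
    ∑ s : Fin r → κ, (∏ i, w (s i)) * (u + ∑ i, g (s i)) ^ 2 =
      u ^ 2 + r * ∑ k, w k * g k ^ 2 := by
  induction r generalizing u with
  | zero => simp
  | succ r ih =>
    rw [← (Fin.consEquiv fun _ => κ).sum_comp, Fintype.sum_prod_type]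
    have h : ∀ k : κ, ∑ s : Fin r → κ, (∏ i, w ((Fin.consEquiv fun _ => κ) (k, s) i)) *
        (u + ∑ i, g ((Fin.consEquiv fun _ => κ) (k, s) i)) ^ 2 =
        w k * ((u + g k) ^ 2 + r * ∑ k, w k * g k ^ 2) := by
      intro k
      rw [← ih (u + g k), Finset.mul_sum]
      refine Finset.sum_congr rfl fun s _ => ?_
      simp only [Fin.consEquiv, Equiv.coe_fn_mk, Fin.prod_univ_succ, Fin.sum_univ_succ,
        Fin.cons_zero, Fin.cons_succ]
      ring
    simp_rw [h]
    set v := ∑ k, w k * g k ^ 2 with hv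
    calc ∑ k, w k * ((u + g k) ^ 2 + r * v)
        = ∑ k, ((u ^ 2 + r * v) * w k + 2 * u * (w k * g k) + w k * g k ^ 2) :=
          Finset.sum_congr rfl fun k _ => by ring
      _ = u ^ 2 + ((r + 1 : ℕ) : ℝ) * v := by
          rw [Finset.sum_add_distrib, Finset.sum_add_distrib, ← Finset.mul_sum, ← Finset.mul_sum,
            hw, hg, ← hv]
          push_cast
          ring

/-- Chebyshev's inequality for a sum of independent centred variables on a finite alphabet. -/
lemma sum_prod_weights_le_of_deviation {κ : Type*} [Fintype κ] (w g : κ → ℝ)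
    (hw0 : ∀ k, 0 ≤ w k) (hw : ∑ k, w k = 1) (hg : ∑ k, w k * g k = 0) (r : ℕ) {τ : ℝ}
    (hτ : 0 < τ) (A : Finset (Fin r → κ)) (hA : ∀ s ∈ A, τ ≤ |∑ i, g (s i)|) :
    ∑ s ∈ A, ∏ i, w (s i) ≤ r * (∑ k, w k * g k ^ 2) / τ ^ 2 := by
  have hp : ∀ s : Fin r → κ, 0 ≤ ∏ i, w (s i) := fun s => Finset.prod_nonneg fun i _ => hw0 _
  rw [le_div_iff₀ (by positivity), Finset.sum_mul]
  calc ∑ s ∈ A, (∏ i, w (s i)) * τ ^ 2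
      ≤ ∑ s ∈ A, (∏ i, w (s i)) * (0 + ∑ i, g (s i)) ^ 2 := by
        refine Finset.sum_le_sum fun s hs => mul_le_mul_of_nonneg_left ?_ (hp s)
        rw [zero_add, ← sq_abs (∑ i, g (s i))]
        exact pow_le_pow_left₀ hτ.le (hA s hs) 2
    _ ≤ ∑ s : Fin r → κ, (∏ i, w (s i)) * (0 + ∑ i, g (s i)) ^ 2 :=
        Finset.sum_le_univ_sum_of_nonneg fun s => mul_nonneg (hp s) (sq_nonneg _)
    _ = r * ∑ k, w k * g k ^ 2 := by
        rw [sum_prod_weights_mul_sq w g hw hg]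
        ring

/-! ### Outcome probabilities of swap tests -/

/-- The outcome distribution of the swap test on two unit vectors with inner product `t`. -/
def swapTestProb (t : ℝ) : Bool → ℝ
  | false => 1 / 2 + t ^ 2 / 2
  | true => 1 / 2 - t ^ 2 / 2

lemma sum_swapTestProb (t : ℝ) : ∑ b, swapTestProb t b = 1 := by
  simp [swapTestProb]
  ring

lemma swapTestProb_nonneg {t : ℝ} (ht : |t| ≤ 1) (b : Bool) : 0 ≤ swapTestProb t b := by
  have : t ^ 2 ≤ 1 := by rw [← sq_abs]; exact pow_le_one₀ (abs_nonneg t) ht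
  cases b <;> simp only [swapTestProb] <;> nlinarith [sq_nonneg t]

/-- On the product state the identity contributes `‖α‖² ‖β‖² = 1`, and the swap contributes `⟨α,
β⟩²`. -/
lemma sum_swapTest_mul {ι : Type*} [Fintype ι] [DecidableEq ι] (α β : EuclideanSpace ℝ ι)
    (hα : ‖α‖ = 1) (hβ : ‖β‖ = 1) (b : Bool) :
    ∑ z : ι × ι, ∑ w : ι × ι,
      swapTest ι b z w * ((α w.1 * β w.2) * (α z.1 * β z.2)) =
      swapTestProb (inner ℝ α β) b := by
  have hα2 : ∑ i, α i * α i = 1 := by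
    have := EuclideanSpace.real_norm_sq_eq α
    rw [hα] at this
    simpa [sq] using this.symm
  have hβ2 : ∑ i, β i * β i = 1 := by
    have := EuclideanSpace.real_norm_sq_eq β
    rw [hβ] at this
    simpa [sq] using this.symm
  have hin : inner ℝ α β = ∑ i, α i * β i := by
    simp [PiLp.inner_apply, mul_comm]
  have h1 : ∑ z : ι × ι, ∑ w : ι × ι,
      (1 : Matrix (ι × ι) (ι × ι) ℝ) z w * ((α w.1 * β w.2) * (α z.1 * β z.2)) = 1 := by
    simp only [Matrix.one_apply, ite_mul, one_mul, zero_mul, Finset.sum_ite_eq, Finset.mem_univ,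
      if_true]
    rw [Fintype.sum_prod_type, ← one_mul (1 : ℝ)]
    nth_rewrite 1 [← hα2]
    rw [← hβ2, Finset.sum_mul_sum]
    exact Finset.sum_congr rfl fun i _ => Finset.sum_congr rfl fun j _ => by ring
  have h2 : ∑ z : ι × ι, ∑ w : ι × ι,
      swapMatrix ι z w * ((α w.1 * β w.2) * (α z.1 * β z.2)) = (inner ℝ α β : ℝ) ^ 2 := by
    have hs : ∀ z w : ι × ι, swapMatrix ι z w = if z.swap = w then 1 else 0 := by
      intro z w
      simp only [swapMatrix, Matrix.of_apply]
      refine if_congr ⟨?_, ?_⟩ rfl rfl <;> rintro rfl <;> simp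
    simp only [hs, ite_mul, one_mul, zero_mul, Finset.sum_ite_eq, Finset.mem_univ,
      if_true, Prod.fst_swap, Prod.snd_swap]
    rw [Fintype.sum_prod_type, hin, sq, Finset.sum_mul_sum]
    exact Finset.sum_congr rfl fun i _ => Finset.sum_congr rfl fun j _ => by ring
  cases b
  · simp only [swapTest, swapTestProb, Matrix.smul_apply, Matrix.add_apply, smul_eq_mul, mul_assoc,
      add_mul, mul_add, Finset.sum_add_distrib, ← Finset.mul_sum] at h1 h2 ⊢
    rw [h1, h2]
    ring
  · simp only [swapTest, swapTestProb, Matrix.smul_apply, Matrix.sub_apply, smul_eq_mul, mul_assoc,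
      sub_mul, mul_sub, Finset.sum_sub_distrib, ← Finset.mul_sum] at h1 h2 ⊢
    rw [h1, h2]
    ring

/-- Both measurement and state are tensor products, so the trace factors and the outcomes are
independent. -/
lemma RepeatedFingerprinting.outcomeProb_eq_prod {X Y : Type*} {q r : ℕ}
    (F : RepeatedFingerprinting X Y q r) (x : X) (y : Y) (s : BitString r) :
    F.outcomeProb x y s = ∏ i, swapTestProb (inner ℝ (F.alice x) (F.bob y)) (s i) := by
  simp_rw [← sum_swapTest_mul (F.alice x) (F.bob y) (F.norm_alice x) (F.norm_bob y)]
  rw [Finset.prod_univ_sum, Fintype.piFinset_univ]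
  simp only [outcomeProb, Matrix.trace, Matrix.diag_apply, Matrix.mul_apply]
  refine Finset.sum_congr rfl fun z _ => ?_
  rw [Finset.prod_univ_sum, Fintype.piFinset_univ]
  refine Finset.sum_congr rfl fun w _ => ?_
  simp only [parallelSwapTest, Matrix.of_apply, Matrix.vecMulVec_apply, jointState,
    Finset.prod_mul_distrib]

/-- A threshold embedding into `q` qubits yields a repeated fingerprinting protocol with a number of
repetitions inversely quadratic in the gap. -/
theorem exists_repeatedFingerprinting_of_gap {X Y : Type*} {D : Set (X × Y)} (f : D → Bool)
    {q : ℕ} (r : ℕ) {δ₀ δ₁ : ℝ} (hδ : δ₀ < δ₁) (hr : 12 ≤ r * (δ₁ - δ₀) ^ 2)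
    (α : X → EuclideanSpace ℝ (BitString q)) (β : Y → EuclideanSpace ℝ (BitString q))
    (hα : ∀ x, ‖α x‖ = 1) (hβ : ∀ y, ‖β y‖ = 1)
    (h₀ : ∀ p : D, f p = false → (inner ℝ (α p.1.1) (β p.1.2) : ℝ) ^ 2 ≤ δ₀)
    (h₁ : ∀ p : D, f p = true → δ₁ ≤ (inner ℝ (α p.1.1) (β p.1.2) : ℝ) ^ 2) :
    ∃ F : RepeatedFingerprinting X Y q r, ComputesWithError F.acceptProb f (1 / 3) := by
  classical
  let N : BitString r → ℝ := fun s => ∑ i, if s i then 0 else 1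
  -- Midpoint of the expected numbers of `0` outcomes at squared inner products `δ₀` and `δ₁`; an
  -- error forces a deviation of at least `r * (δ₁ - δ₀) / 4`.
  let θ : ℝ := r * (1 / 2 + (δ₀ + δ₁) / 4)
  let F : RepeatedFingerprinting X Y q r := ⟨α, β, hα, hβ, fun s => decide (θ ≤ N s)⟩
  have hr0 : (0 : ℝ) < r := by
    by_contra h
    nlinarith [sq_nonneg (δ₁ - δ₀)]
  have key : ∀ (t : ℝ), |t| ≤ 1 → ∀ A : Finset (BitString r),
      (∀ s ∈ A, r * ((δ₁ - δ₀) / 4) ≤ |N s - r * (1 / 2 + t ^ 2 / 2)|) →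
      ∑ s ∈ A, ∏ i, swapTestProb t (s i) ≤ 1 / 3 := by
    intro t ht A hA
    let g : Bool → ℝ := fun b => (if b then 0 else 1) - (1 / 2 + t ^ 2 / 2)
    have hτ : 0 < r * ((δ₁ - δ₀) / 4) := mul_pos hr0 (by linarith)
    refine (sum_prod_weights_le_of_deviation (swapTestProb t) g (swapTestProb_nonneg ht)
      (sum_swapTestProb t) ?_ r hτ A ?_).trans ?_
    · simp [g, swapTestProb]
      ring
    · intro s hs
      convert hA s hs using 2
      simp [g, N, Finset.sum_sub_distrib, mul_add]
    -- With variance at most `1/4`, Chebyshev gives `4 / (r * (δ₁ - δ₀) ^ 2)`, hence the constant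
    -- `12` in `hr`.
    · have hv : ∑ k, swapTestProb t k * g k ^ 2 ≤ 1 / 4 := by
        simp [g, swapTestProb]
        nlinarith [sq_nonneg (t ^ 2)]
      rw [div_le_iff₀ (by positivity)]
      nlinarith
  have habs : ∀ x y, |(inner ℝ (α x) (β y) : ℝ)| ≤ 1 := fun x y => by
    simpa [hα, hβ] using abs_real_inner_le_norm (α x) (β y)
  have hacc : ∀ x y, F.acceptProb x y =
      ∑ s with θ ≤ N s, ∏ i, swapTestProb (inner ℝ (α x) (β y)) (s i) := by
    intro x y
    simp only [RepeatedFingerprinting.acceptProb, F.outcomeProb_eq_prod, F, decide_eq_true_eq,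
      Finset.sum_filter]
  refine ⟨F, fun p => ⟨fun hp => ?_, fun hp => ?_⟩⟩
  · rw [hacc]
    have h1 := h₁ p hp
    have htot := sum_prod_weights_eq_one (ι := Fin r) _
      (sum_swapTestProb (inner ℝ (α p.1.1) (β p.1.2)))
    rw [← Finset.sum_filter_add_sum_filter_not _ (fun s => θ ≤ N s)] at htot
    have := key _ (habs p.1.1 p.1.2) {s | ¬ θ ≤ N s} (by
      intro s hs
      rw [Finset.mem_filter, not_le] at hs
      refine le_trans ?_ (neg_le_abs _)
      have := hs.2
      simp only [θ] at this
      nlinarith)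
    linarith
  · rw [hacc]
    have h0 := h₀ p hp
    refine key _ (habs p.1.1 p.1.2) _ fun s hs => ?_
    rw [Finset.mem_filter] at hs
    refine le_trans ?_ (le_abs_self _)
    have := hs.2
    simp only [θ] at this
    nlinarith

/-! ### The threshold embedding of a public-coin protocol -/

lemma PublicCoinSMP.acceptProb_uniformOn {X Y : Type*} {c m : ℕ}
    (π : PublicCoinSMP (Fin m) X Y c) (x : X) (y : Y) :
    π.acceptProb (uniformOn Set.univ) x y =
      (∑ ω, π.referee ω (π.alice ω x) (π.bob ω y)) / m := by
  simp only [acceptProb, uniformOn, ProbabilityTheory.cond, Measure.restrict_univ,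
    integral_smul_measure, integral_count, Measure.count_univ]
  simp [div_eq_inv_mul]

/-- Alice's fingerprint: a uniform superposition of her messages together with the coin. -/
def aliceVector {X : Type*} {c m : ℕ} (a : Fin m → X → BitString c) (x : X) :
    EuclideanSpace ℝ (Fin m × Option (BitString c)) :=
  WithLp.toLp 2 fun p => if p.2 = some (a p.1 x) then 1 / √m else 0

/-- Bob's fingerprint: the acceptance probabilities of the referee given Bob's message and the coin,
with one more coordinate for each coin value, which makes the vector a unit vector. -/
def bobVector {Y : Type*} {c m : ℕ} (b : Fin m → Y → BitString c)
    (R : Fin m → BitString c → BitString c → ℝ) (y : Y) :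
    EuclideanSpace ℝ (Fin m × Option (BitString c)) :=
  WithLp.toLp 2 fun p => p.2.elim (√(1 - (∑ a, R p.1 a (b p.1 y) ^ 2) / 2 ^ c) / √m)
    fun a => R p.1 a (b p.1 y) / √(2 ^ c) / √m

lemma norm_aliceVector {X : Type*} {c m : ℕ} (hm : 0 < m) (a : Fin m → X → BitString c) (x : X) :
    ‖aliceVector a x‖ = 1 := by
  have hm' : (m : ℝ) ≠ 0 := by positivity
  rw [← sq_eq_sq₀ (norm_nonneg _) zero_le_one, EuclideanSpace.real_norm_sq_eq,
    Fintype.sum_prod_type]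
  simp [aliceVector, ite_pow, hm']

lemma norm_bobVector {Y : Type*} {c m : ℕ} (hm : 0 < m) (b : Fin m → Y → BitString c)
    (R : Fin m → BitString c → BitString c → ℝ) (hR : ∀ ω a b, R ω a b ∈ Set.Icc (0 : ℝ) 1)
    (y : Y) : ‖bobVector b R y‖ = 1 := by
  have hm' : (m : ℝ) ≠ 0 := by positivity
  have hle : ∀ ω, (∑ a, R ω a (b ω y) ^ 2) / 2 ^ c ≤ 1 := fun ω => by
    rw [div_le_one (by positivity)]
    calc ∑ a, R ω a (b ω y) ^ 2 ≤ ∑ _a : BitString c, (1 : ℝ) :=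
          Finset.sum_le_sum fun a _ => pow_le_one₀ (hR _ _ _).1 (hR _ _ _).2
      _ = 2 ^ c := by simp
  rw [← sq_eq_sq₀ (norm_nonneg _) zero_le_one, EuclideanSpace.real_norm_sq_eq,
    Fintype.sum_prod_type]
  have : ∀ ω, ∑ o, bobVector b R y (ω, o) ^ 2 = 1 / m := by
    intro ω
    rw [Fintype.sum_option]
    simp only [bobVector, Option.elim_none, Option.elim_some, div_pow]
    rw [Real.sq_sqrt (by linarith [hle ω]), Real.sq_sqrt (by positivity),
      Real.sq_sqrt (by positivity), ← Finset.sum_div, ← Finset.sum_div]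
    ring
  simp [this, hm']

/-- For each coin value Alice's indicator selects one entry of Bob's list; her `none` coordinate is
zero, so Bob's padding does not contribute. -/
lemma inner_aliceVector_bobVector {X Y : Type*} {c m : ℕ} (a : Fin m → X → BitString c)
    (b : Fin m → Y → BitString c) (R : Fin m → BitString c → BitString c → ℝ) (x : X) (y : Y) :
    inner ℝ (aliceVector a x) (bobVector b R y) =
      (∑ ω, R ω (a ω x) (b ω y)) / m / √(2 ^ c) := by
  have h : ∀ ω, ∑ o, aliceVector a x (ω, o) * bobVector b R y (ω, o) =
      R ω (a ω x) (b ω y) / m / √(2 ^ c) := by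
    intro ω
    rw [Fintype.sum_option]
    simp only [aliceVector, bobVector, Option.elim_none, Option.elim_some, Option.some_inj,
      ite_mul, zero_mul, Finset.sum_ite_eq', Finset.mem_univ, if_true]
    have : √(m : ℝ) * √(m : ℝ) = m := Real.mul_self_sqrt (by positivity)
    rw [if_neg (by simp), zero_add]
    nth_rewrite 3 [← this]
    simp only [div_eq_mul_inv, mul_inv]
    ring
  rw [PiLp.inner_apply, Fintype.sum_prod_type, Finset.sum_div, Finset.sum_div]
  refine Finset.sum_congr rfl fun ω _ => ?_
  rw [← h ω]
  simp [mul_comm]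

theorem PublicCoinSMP.exists_fingerprints {X Y : Type*} {c m : ℕ} (hm : 0 < m)
    (π : PublicCoinSMP (Fin m) X Y c) :
    ∃ (α : X → EuclideanSpace ℝ (Fin (m * (2 ^ c + 1))))
      (β : Y → EuclideanSpace ℝ (Fin (m * (2 ^ c + 1)))),
      (∀ x, ‖α x‖ = 1) ∧ (∀ y, ‖β y‖ = 1) ∧
      ∀ x y, inner ℝ (α x) (β y) = π.acceptProb (uniformOn Set.univ) x y / √(2 ^ c) := by
  let e : Fin m × Option (BitString c) ≃ Fin (m * (2 ^ c + 1)) :=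
    Fintype.equivFinOfCardEq (by simp)
  let U := LinearIsometryEquiv.piLpCongrLeft 2 ℝ ℝ e
  refine ⟨fun x => U (aliceVector π.alice x), fun y => U (bobVector π.bob π.referee y),
    fun x => ?_, fun y => ?_, fun x y => ?_⟩
  · rw [U.norm_map, norm_aliceVector hm]
  · rw [U.norm_map, norm_bobVector hm _ _ π.referee_mem]
  · rw [U.inner_map_map, inner_aliceVector_bobVector, π.acceptProb_uniformOn]

lemma PublicCoinSMP.acceptProb_nonneg {Ω X Y : Type*} [MeasurableSpace Ω] {c : ℕ}
    (π : PublicCoinSMP Ω X Y c) (μ : Measure Ω) (x : X) (y : Y) : 0 ≤ π.acceptProb μ x y :=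
  integral_nonneg fun _ => (π.referee_mem _ _ _).1

lemma isThresholdEmbedding_of_inner_eq {X Y : Type*} {D : Set (X × Y)} (f : D → Bool) {d c : ℕ}
    {α : X → EuclideanSpace ℝ (Fin d)} {β : Y → EuclideanSpace ℝ (Fin d)}
    (hα : ∀ x, ‖α x‖ = 1) (hβ : ∀ y, ‖β y‖ = 1) {P : X → Y → ℝ} (hP : ∀ x y, 0 ≤ P x y)
    (hin : ∀ x y, inner ℝ (α x) (β y) = P x y / √(2 ^ c)) {ε : ℝ} (hε : ε ≤ 1)
    (hf : ComputesWithError P f ε) :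
    IsThresholdEmbedding f d (ε ^ 2 / 2 ^ c) ((1 - ε) ^ 2 / 2 ^ c) α β := by
  refine ⟨hα, hβ, fun p => ?_⟩
  rw [hin, sq_abs, div_pow, Real.sq_sqrt (by positivity)]
  refine ⟨fun h => ?_, fun h => ?_⟩
  · gcongr
    · exact hP _ _
    · exact (hf p).2 h
  · have := (hf p).1 h
    have := sub_nonneg.2 hε
    gcongr

/-- Padding a vector with zeros along an injection of index types. -/
def extendByZero {ι κ : Type*} (e : ι → κ) (v : EuclideanSpace ℝ ι) : EuclideanSpace ℝ κ :=
  WithLp.toLp 2 (Function.extend e v 0)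

lemma inner_extendByZero {ι κ : Type*} [Fintype ι] [Fintype κ] {e : ι → κ}
    (he : Function.Injective e) (v w : EuclideanSpace ℝ ι) :
    inner ℝ (extendByZero e v) (extendByZero e w) = inner ℝ v w := by
  rw [PiLp.inner_apply, PiLp.inner_apply]
  refine (Fintype.sum_of_injective e he _ _ (fun k hk => ?_) fun i => ?_).symm
  · have : ¬ ∃ i, e i = k := hk
    simp [extendByZero, Function.extend_apply' _ _ _ this]
  · simp [extendByZero, he.extend_apply]

lemma norm_extendByZero {ι κ : Type*} [Fintype ι] [Fintype κ] {e : ι → κ}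
    (he : Function.Injective e) (v : EuclideanSpace ℝ ι) : ‖extendByZero e v‖ = ‖v‖ := by
  rw [norm_eq_sqrt_real_inner, norm_eq_sqrt_real_inner, inner_extendByZero he]

/-! ### Reducing the public coin to few values -/

/-- Hoeffding's inequality for `m` independent samples of a variable with range of length `1`. -/
lemma measure_pi_le_sum_sub_le {Ω : Type*} [MeasurableSpace Ω] (μ : Measure Ω)
    [IsProbabilityMeasure μ] {X : Ω → ℝ} (hX : Measurable X) {a b : ℝ} (hab : b - a = 1)
    (hmem : ∀ ω, X ω ∈ Set.Icc a b) (m : ℕ) {ε : ℝ} (hε : 0 ≤ ε) :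
    (Measure.pi fun _ : Fin m => μ).real {ω | m * ε ≤ ∑ i, (X (ω i) - ∫ ω, X ω ∂μ)} ≤
      Real.exp (-(2 * m * ε ^ 2)) := by
  have hind : iIndepFun (fun (i : Fin m) (ω : Fin m → Ω) => X (ω i) - ∫ ω, X ω ∂μ)
      (Measure.pi fun _ => μ) :=
    iIndepFun_pi (X := fun _ ω => X ω - ∫ ω, X ω ∂μ) fun _ => (hX.sub_const _).aemeasurable
  have hsub : ∀ i ∈ (Finset.univ : Finset (Fin m)),
      HasSubgaussianMGF (fun ω : Fin m → Ω => X (ω i) - ∫ ω, X ω ∂μ)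
        ((fun _ => (‖b - a‖₊ / 2) ^ 2) i) (Measure.pi fun _ => μ) := by
    intro i _
    have := hasSubgaussianMGF_of_mem_Icc (μ := Measure.pi fun _ : Fin m => μ)
      (X := fun ω => X (ω i)) (hX.comp (measurable_pi_apply i)).aemeasurable
      (Filter.Eventually.of_forall fun ω => hmem (ω i))
    rwa [integral_comp_eval (μ := fun _ : Fin m => μ) (f := X) hX.aestronglyMeasurable] at this
  refine (HasSubgaussianMGF.measure_sum_ge_le_of_iIndepFun hind hsub (by positivity)).trans ?_
  refine Real.exp_le_exp.2 (le_of_eq ?_)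
  -- For `m = 0` the Hoeffding exponent is a division by zero, read as `0`, which agrees with the
  -- bound.
  rcases Nat.eq_zero_or_pos m with rfl | hm
  · simp
  · have : (m : ℝ) ≠ 0 := by positivity
    simp [hab]
    field_simp

/-- Finitely many `[0,1]`-valued variables are simultaneously approximated by an empirical mean. -/
theorem exists_empirical_mean_close {Ω ι : Type*} [MeasurableSpace Ω] [Fintype ι] (μ : Measure Ω)
    [IsProbabilityMeasure μ] (X : ι → Ω → ℝ) (hX : ∀ j, Measurable (X j))
    (hmem : ∀ j ω, X j ω ∈ Set.Icc (0 : ℝ) 1) {m : ℕ} (hm : 0 < m) {ε : ℝ} (hε : 0 ≤ ε)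
    (hcard : 2 * Fintype.card ι * Real.exp (-(2 * m * ε ^ 2)) < 1) :
    ∃ ω : Fin m → Ω, ∀ j, |(∑ i, X j (ω i)) / m - ∫ ω, X j ω ∂μ| ≤ ε := by
  by_contra! hcon
  let ν := Measure.pi fun _ : Fin m => μ
  let A : ι → Set (Fin m → Ω) := fun j => {ω | m * ε ≤ ∑ i, (X j (ω i) - ∫ ω, X j ω ∂μ)}
  -- Lower deviations, seen as upper deviations of `-X j`.
  let B : ι → Set (Fin m → Ω) := fun j => {ω | m * ε ≤ ∑ i, (-X j (ω i) - ∫ ω, -X j ω ∂μ)}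
  have hcover : (Set.univ : Set (Fin m → Ω)) ⊆ ⋃ j, A j ∪ B j := by
    intro ω _
    obtain ⟨j, hj⟩ := hcon ω
    refine Set.mem_iUnion.2 ⟨j, ?_⟩
    have hm' : (0 : ℝ) < m := by positivity
    have hmul : (∑ i, X j (ω i)) / m * m = ∑ i, X j (ω i) := div_mul_cancel₀ _ hm'.ne'
    simp only [A, B, Set.mem_union, Set.mem_ofPred_eq, Finset.sum_sub_distrib,
      Finset.sum_neg_distrib, integral_neg, Finset.sum_const, Finset.card_univ, Fintype.card_fin,
      nsmul_eq_mul]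
    rcases lt_abs.1 hj with h | h
    · left
      nlinarith
    · right
      nlinarith
  have hA : ∀ j, ν.real (A j) ≤ Real.exp (-(2 * m * ε ^ 2)) := fun j =>
    measure_pi_le_sum_sub_le μ (hX j) (by norm_num) (hmem j) m hε
  have hB : ∀ j, ν.real (B j) ≤ Real.exp (-(2 * m * ε ^ 2)) := fun j =>
    measure_pi_le_sum_sub_le μ (hX j).neg (a := -1) (b := 0) (by norm_num)
      (fun ω => ⟨neg_le_neg (hmem j ω).2, by simpa using (hmem j ω).1⟩) m hε
  have : (1 : ℝ) ≤ 2 * Fintype.card ι * Real.exp (-(2 * m * ε ^ 2)) := by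
    calc (1 : ℝ) = ν.real Set.univ := by simp [ν]
      _ ≤ ν.real (⋃ j, A j ∪ B j) := measureReal_mono hcover
      _ ≤ ∑ j, ν.real (A j ∪ B j) := measureReal_iUnion_fintype_le _
      _ ≤ ∑ _j : ι, 2 * Real.exp (-(2 * m * ε ^ 2)) := Finset.sum_le_sum fun j _ => by
          refine (measureReal_union_le _ _).trans ?_
          linarith [hA j, hB j]
      _ = _ := by simp; ring
  linarith

/-- The protocol whose public coin is an index into a fixed list of coin values. -/
def PublicCoinSMP.sample {Ω X Y : Type*} [MeasurableSpace Ω] {c m : ℕ}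
    (π : PublicCoinSMP Ω X Y c) (ω : Fin m → Ω) : PublicCoinSMP (Fin m) X Y c where
  alice i := π.alice (ω i)
  bob i := π.bob (ω i)
  referee i := π.referee (ω i)
  referee_mem i := π.referee_mem (ω i)
  measurable_alice _ := measurable_of_finite _
  measurable_bob _ := measurable_of_finite _
  measurable_referee _ _ := measurable_of_finite _

/-- There are finitely many message pairs, so the output splits into finitely many measurable
pieces. -/
lemma PublicCoinSMP.measurable_output {Ω X Y : Type*} [MeasurableSpace Ω] {c : ℕ}
    (π : PublicCoinSMP Ω X Y c) (x : X) (y : Y) :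
    Measurable fun ω => π.referee ω (π.alice ω x) (π.bob ω y) := by
  have : (fun ω => π.referee ω (π.alice ω x) (π.bob ω y)) =
      fun ω => ∑ a, ∑ b, if π.alice ω x = a ∧ π.bob ω y = b then π.referee ω a b else 0 := by
    ext ω
    simp [ite_and]
  rw [this]
  refine Finset.measurable_sum _ fun a _ => Finset.measurable_sum _ fun b _ => ?_
  exact Measurable.ite ((π.measurable_alice x (measurableSet_singleton a)).inter
    (π.measurable_bob y (measurableSet_singleton b))) (π.measurable_referee a b) measurable_const

/-- A protocol on `n`-bit inputs keeps its acceptance probabilities up to `1 / 24` when the public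
coin is restricted to a suitable list of `O(n)` values. -/
theorem PublicCoinSMP.exists_sample_close {Ω : Type*} [MeasurableSpace Ω] (μ : Measure Ω)
    [IsProbabilityMeasure μ] {n c : ℕ} (hn : 0 < n)
    (π : PublicCoinSMP Ω (BitString n) (BitString n) c) :
    ∃ ω : Fin (2 ^ 12 * n) → Ω, ∀ x y,
      |(∑ i, π.referee (ω i) (π.alice (ω i) x) (π.bob (ω i) y)) / (2 ^ 12 * n : ℕ) -
        π.acceptProb μ x y| ≤ 1 / 24 := by
  -- The union bound has at most `2 ^ (3 * n)` terms, as `1 ≤ n`, and the Hoeffding exponent `2 * 2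
  -- ^ 12 * n / 24 ^ 2` exceeds `3 * n`.
  obtain ⟨ω, hω⟩ := exists_empirical_mean_close μ
    (fun (p : BitString n × BitString n) ω => π.referee ω (π.alice ω p.1) (π.bob ω p.2))
    (fun p => π.measurable_output p.1 p.2) (fun p ω => π.referee_mem _ _ _)
    (m := 2 ^ 12 * n) (by positivity) (ε := 1 / 24) (by norm_num) (by
      have h1 : (2 : ℝ) ^ (3 * n) < Real.exp (2 * (2 ^ 12 * n : ℕ) * (1 / 24) ^ 2) := by
        calc (2 : ℝ) ^ (3 * n) < Real.exp 1 ^ (3 * n) := by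
              have := Real.exp_one_gt_d9
              exact pow_lt_pow_left₀ (by linarith) (by norm_num) (by lia)
          _ = Real.exp ((3 * n : ℕ) : ℝ) := by rw [← Real.exp_nat_mul, mul_one]
          _ ≤ _ := Real.exp_le_exp.2 (by
              have : (0 : ℝ) ≤ n := by positivity
              push_cast
              linarith)
      have h2 : (2 : ℝ) * Fintype.card (BitString n × BitString n) ≤ 2 ^ (3 * n) := by
        have : (2 : ℝ) * Fintype.card (BitString n × BitString n) = 2 ^ (1 + n + n) := by
          simp [pow_add]
          ring
        rw [this]
        exact pow_le_pow_right₀ (by norm_num) (by lia)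
      rw [Real.exp_neg, ← div_eq_mul_inv, div_lt_one (Real.exp_pos _)]
      exact h2.trans_lt h1)
  exact ⟨ω, fun x y => hω (x, y)⟩

/-! ### Simulation of public-coin protocols by repeated fingerprinting -/

lemma PublicCoinSMP.acceptProb_eq_of_no_communication {Ω X Y : Type*} [MeasurableSpace Ω]
    (π : PublicCoinSMP Ω X Y 0) (μ : Measure Ω) (x x' : X) (y y' : Y) :
    π.acceptProb μ x y = π.acceptProb μ x' y' := by
  refine integral_congr_ae (Filter.Eventually.of_forall fun ω => ?_)
  simp only [Subsingleton.elim (π.alice ω x) (π.alice ω x'),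
    Subsingleton.elim (π.bob ω y) (π.bob ω y')]

lemma exists_repeatedFingerprinting_of_const {X Y : Type*} {D : Set (X × Y)} (f : D → Bool)
    (b : Bool) (hf : ∀ p, f p = b) :
    ∃ F : RepeatedFingerprinting X Y 0 0, ComputesWithError F.acceptProb f (1 / 3) := by
  let v : EuclideanSpace ℝ (BitString 0) := EuclideanSpace.single default 1
  have hv : ‖v‖ = 1 := by simp [v]
  let F : RepeatedFingerprinting X Y 0 0 :=
    ⟨fun _ => v, fun _ => v, fun _ => hv, fun _ => hv, fun _ => b⟩
  refine ⟨F, fun p => ?_⟩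
  simp only [hf p, RepeatedFingerprinting.acceptProb, F.outcomeProb_eq_prod, F]
  constructor <;> rintro rfl <;> norm_num

/-- Sampling raises the error to `1/3 + 1/24 = 3/8`. The register holds the coin index in `12 +
Nat.clog 2 n` qubits and the `2 ^ c + 1` message coordinates in `c + 1`. -/
theorem PublicCoinSMP.exists_repeatedFingerprinting {Ω : Type*} [MeasurableSpace Ω]
    (μ : Measure Ω) [IsProbabilityMeasure μ] {n c : ℕ} (hn : 0 < n)
    (π : PublicCoinSMP Ω (BitString n) (BitString n) c)
    {D : Set (BitString n × BitString n)} (f : D → Bool)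
    (hf : ComputesWithError (π.acceptProb μ) f (1 / 3)) :
    ∃ F : RepeatedFingerprinting (BitString n) (BitString n) (12 + Nat.clog 2 n + (c + 1))
      (192 * 4 ^ c), ComputesWithError F.acceptProb f (1 / 3) := by
  obtain ⟨ω, hω⟩ := π.exists_sample_close μ hn
  have hf' : ComputesWithError ((π.sample ω).acceptProb (uniformOn Set.univ)) f (3 / 8) := by
    intro p
    have h := abs_le.1 (hω p.1.1 p.1.2)
    rw [PublicCoinSMP.acceptProb_uniformOn]
    simp only [PublicCoinSMP.sample]
    exact ⟨fun hp => by linarith [(hf p).1 hp, h.1], fun hp => by linarith [(hf p).2 hp, h.2]⟩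
  obtain ⟨α, β, hα, hβ, hin⟩ :=
    (π.sample ω).exists_fingerprints (by positivity : 0 < 2 ^ 12 * n)
  obtain ⟨-, -, hemb⟩ := isThresholdEmbedding_of_inner_eq f hα hβ
    (fun x y => acceptProb_nonneg _ _ x y) hin (by norm_num) hf'
  have hcard : 2 ^ 12 * n * (2 ^ c + 1) ≤ 2 ^ (12 + Nat.clog 2 n + (c + 1)) := by
    rw [pow_add, pow_add 2 12]
    gcongr
    · exact Nat.le_pow_clog (by norm_num) n
    · have := Nat.one_le_two_pow (n := c)
      rw [pow_succ]
      lia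
  obtain ⟨e⟩ : Nonempty (Fin (2 ^ 12 * n * (2 ^ c + 1)) ↪
      BitString (12 + Nat.clog 2 n + (c + 1))) :=
    Function.Embedding.nonempty_of_card_le (by simpa using hcard)
  -- The squared gap is `1 / (16 * 4 ^ c)`, so `12 * 16 = 192` accounts for the number of
  -- repetitions.
  have hgap : ((1 - 3 / 8) ^ 2 / 2 ^ c - (3 / 8) ^ 2 / 2 ^ c : ℝ) = 1 / 4 / 2 ^ c := by ring
  have hpow : (4 : ℝ) ^ c = (2 ^ c) ^ 2 := by rw [← pow_mul, mul_comm, pow_mul]; norm_num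
  refine exists_repeatedFingerprinting_of_gap f (192 * 4 ^ c)
    (δ₀ := (3 / 8) ^ 2 / 2 ^ c) (δ₁ := (1 - 3 / 8) ^ 2 / 2 ^ c) ?_ ?_
    (fun x => extendByZero e (α x)) (fun y => extendByZero e (β y))
    (fun x => by rw [norm_extendByZero e.injective, hα])
    (fun y => by rw [norm_extendByZero e.injective, hβ]) ?_ ?_
  · rw [← sub_pos, hgap]
    positivity
  · rw [hgap]
    push_cast
    rw [hpow]
    field_simp
    norm_num
  · intro p hp
    rw [inner_extendByZero e.injective, ← sq_abs]
    exact (hemb p).1 hp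
  · intro p hp
    rw [inner_extendByZero e.injective, ← sq_abs (inner ℝ _ _)]
    exact (hemb p).2 hp

lemma clog_two_le_logb_add_one {n : ℕ} (hn : 0 < n) :
    (Nat.clog 2 n : ℝ) ≤ Real.logb 2 n + 1 := by
  rcases eq_or_lt_of_le (Nat.one_le_of_lt hn) with h | h
  · subst h
    simp
  · have h1 := Nat.pow_pred_clog_lt_self (b := 2) (by norm_num) h
    have h2 : (2 : ℝ) ^ ((Nat.clog 2 n - 1 : ℕ) : ℝ) ≤ n := by
      rw [Real.rpow_natCast]
      exact_mod_cast h1.le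
    have h3 := (Real.le_logb_iff_rpow_le (by norm_num) (by positivity)).2 h2
    have h4 : (Nat.clog 2 n : ℝ) ≤ ((Nat.clog 2 n - 1 : ℕ) : ℝ) + 1 := by
      exact_mod_cast (by lia : Nat.clog 2 n ≤ Nat.clog 2 n - 1 + 1)
    linarith

end

theorem mainTheorem4 :
    -- the threshold embedding obtained from a protocol with `n'` equally likely random strings
    (∀ (n c n' : ℕ) (_ : 0 < n') (π : PublicCoinSMP (Fin n') (BitString n) (BitString n) c),
      ∃ (α β : BitString n → EuclideanSpace ℝ (Fin (n' * (2 ^ c + 1)))),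
        (∀ x, ‖α x‖ = 1) ∧ (∀ y, ‖β y‖ = 1) ∧
        (∀ x y, inner ℝ (α x) (β y) =
          π.acceptProb (uniformOn Set.univ) x y / Real.sqrt (2 ^ c)) ∧
        ∀ (D : Set (BitString n × BitString n)) (f : D → Bool),
          ComputesWithError (π.acceptProb (uniformOn Set.univ)) f (1 / 3) →
          IsThresholdEmbedding f (n' * (2 ^ c + 1)) (1 / (9 * 2 ^ c)) (4 / (9 * 2 ^ c)) α β) ∧
    -- the simulation of an arbitrary public-coin protocol
    (∃ C : ℝ, ∀ (n c : ℕ) (_ : 0 < n) (Ω : Type*) [MeasurableSpace Ω] (μ : Measure Ω)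
      [IsProbabilityMeasure μ] (π : PublicCoinSMP Ω (BitString n) (BitString n) c)
      (D : Set (BitString n × BitString n)) (f : D → Bool),
      ComputesWithError (π.acceptProb μ) f (1 / 3) →
      ∃ (q r : ℕ) (F : RepeatedFingerprinting (BitString n) (BitString n) q r),
        ComputesWithError F.acceptProb f (1 / 3) ∧
        (F.cost : ℝ) ≤ C * (2 ^ (2 * c) * ((c : ℝ) + Real.logb 2 n))) := by
  refine ⟨fun n c n' hn' π => ?_, 5760, fun n c hn Ω _ μ _ π D f hf => ?_⟩
  · obtain ⟨α, β, hα, hβ, hin⟩ := π.exists_fingerprints hn'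
    refine ⟨α, β, hα, hβ, hin, fun D f hf => ?_⟩
    convert isThresholdEmbedding_of_inner_eq f hα hβ
      (fun x y => π.acceptProb_nonneg _ x y) hin (by norm_num) hf using 1 <;>
    · field_simp
      norm_num
  · have hlog : 0 ≤ Real.logb 2 n := Real.logb_nonneg (by norm_num) (by exact_mod_cast hn)
    -- For `c = 0` and `n = 1` the allowed cost is zero. Without communication acceptance ignores
    -- the input, so `f` is constant and no qubits are needed.
    rcases Nat.eq_zero_or_pos c with rfl | hc
    · obtain ⟨b, hb⟩ : ∃ b, ∀ p, f p = b := by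
        by_cases h : ∃ p, f p = true
        · obtain ⟨p, hp⟩ := h
          refine ⟨true, fun p' => ?_⟩
          by_contra hp'
          have h1 := (hf p).1 hp
          have h2 := (hf p').2 (by simpa using hp')
          rw [π.acceptProb_eq_of_no_communication μ _ p.1.1 _ p.1.2] at h2
          linarith
        · exact ⟨false, fun p => by simpa using fun hp => h ⟨p, hp⟩⟩
      obtain ⟨F, hF⟩ := exists_repeatedFingerprinting_of_const f b hb
      refine ⟨0, 0, F, hF, ?_⟩
      simp only [RepeatedFingerprinting.cost]
      push_cast
      positivity
    · obtain ⟨F, hF⟩ := π.exists_repeatedFingerprinting μ hn f hf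
      refine ⟨_, _, F, hF, ?_⟩
      have hclog := clog_two_le_logb_add_one hn
      have hc' : (1 : ℝ) ≤ c := by exact_mod_cast hc
      have hpow : (2 : ℝ) ^ (2 * c) = 4 ^ c := by rw [pow_mul]; norm_num
      have h4 : (0 : ℝ) < 4 ^ c := by positivity
      simp only [RepeatedFingerprinting.cost]
      push_cast
      rw [hpow]
      calc 2 * (12 + (Nat.clog 2 n : ℝ) + (c + 1)) * (192 * 4 ^ c)
          = 384 * (12 + (Nat.clog 2 n : ℝ) + (c + 1)) * 4 ^ c := by ring
        -- The additive constant is `12 + 1 + 1 = 14`, absorbed as `14 * c` since `1 ≤ c`; thus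
        -- `5760 = 384 * 15`.
        _ ≤ 384 * (15 * (c + Real.logb 2 n)) * 4 ^ c := by
            gcongr
            linarith
        _ = _ := by ring
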